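/- Let $\mathit{Atm}$ be a nonempty countable set of atomic propositions, given with an effective coding by natural numbers, and let $\mathit{Agt}=\{1,\dots,n\}$ be a finite set of agents ($n\ge 0$). Programs $\alpha$ and formulas $\varphi$ of the Dynamic Logic of Space $\mathsf{DL\text{-}S}^*$ are given by $$\alpha ::= {\Uparrow}\mid{\Downarrow}\mid{\Rightarrow}\mid{\Leftarrow}\mid \alpha;\alpha'\mid \alpha\cup\alpha'\mid\alpha^*\mid \varphi?,\qquad \varphi ::= p\mid \mathsf{h}_i\mid\neg\varphi\mid\varphi\wedge\psi\mid[\alpha]\varphi,$$ with $p\in\mathit{Atm}$ and $i\in\mathit{Agt}$ (where $\mathsf{h}_i$ reads ``agent $i$ is here''). A spatial model $M=(P,V)$ consists of maps $P:\mathit{Agt}\to\mathbb Z\times\mathbb Z$ and $V:\mathbb Z\times\mathbb Z\to 2^{\mathit{Atm}}$. Relations $R_\alpha$ on $\mathbb Z\times\mathbb Z$ and truth at positions are defined simultaneously: $R_{\Uparrow},R_{\Downarrow},R_{\Rightarrow},R_{\Leftarrow}$ relate $(x,y)$ exactly to $(x,y+1)$, $(x,y-1)$, $(x+1,y)$, $(x-1,y)$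 respectively; $R_{\alpha;\beta}$ is the composition (first $R_\alpha$, then $R_\beta$), $R_{\alpha\cup\beta}=R_\alpha\cup R_\beta$, $R_{\alpha^*}$ is the reflexive transitive closure of $R_\alpha$, and $R_{\varphi?}=\{(z,z): M,z\models\varphi\}$; $M,z\models p$ iff $p\in V(z)$; $M,z\models \mathsf{h}_i$ iff $P(i)=z$; negation and conjunction are classical; $M,z\models[\alpha]\varphi$ iff $M,w\models\varphi$ for all $w$ with $z\mathrel{R_\alpha}w$. A formula is valid if it is true at every position of every spatial model, and satisfiable if its negation is not valid. Then the set of valid formulas of $\mathsf{DL\text{-}S}^*$ is not computably enumerable, and the satisfiability problem of $\mathsf{DL\text{-}S}^*$ (given a formula, is it satisfiable?) is undecidable, where formulas are coded by their Gödel numbers. -/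

import Mathlib

namespace DLS

universe u

mutual

/-- Spatial programs over the atomic propositions `Atm` and the agents `Fin n`. -/
inductive Program (Atm : Type u) (n : ℕ) : Type u
  | up : Program Atm n
  | down : Program Atm n
  | right : Program Atm n
  | left : Program Atm n
  | seq : Program Atm n → Program Atm n → Program Atm n
  | choice : Program Atm n → Program Atm n → Program Atm n
  | iter : Program Atm n → Program Atm n
  | test : Formula Atm n → Program Atm n

/-- Formulas over the atomic propositions `Atm` and the agents `Fin n`;
`here i` is the positional atom "agent `i` is here", `box α φ` is `[α]φ`. -/
inductive Formula (Atm : Type u) (n : ℕ) : Type u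
  | atom : Atm → Formula Atm n
  | here : Fin n → Formula Atm n
  | neg : Formula Atm n → Formula Atm n
  | and : Formula Atm n → Formula Atm n → Formula Atm n
  | box : Program Atm n → Formula Atm n → Formula Atm n

end

/-- Spatial models: positions of the agents in `ℤ × ℤ`, and the set of atomic propositions
true at each position. -/
structure SpatialModel (Atm : Type u) (n : ℕ) where
  P : Fin n → ℤ × ℤ
  V : ℤ × ℤ → Set Atm

mutual

/-- The accessibility relation of a program in a spatial model. -/
def Program.Rel {Atm : Type u} {n : ℕ} (M : SpatialModel Atm n) :
    Program Atm n → ℤ × ℤ → ℤ × ℤ → Prop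
  | .up => fun z w => w.1 = z.1 ∧ w.2 = z.2 + 1
  | .down => fun z w => w.1 = z.1 ∧ w.2 = z.2 - 1
  | .right => fun z w => w.1 = z.1 + 1 ∧ w.2 = z.2
  | .left => fun z w => w.1 = z.1 - 1 ∧ w.2 = z.2
  | .seq α β => Relation.Comp (Program.Rel M α) (Program.Rel M β)
  | .choice α β => fun z w => Program.Rel M α z w ∨ Program.Rel M β z w
  | .iter α => Relation.ReflTransGen (Program.Rel M α)
  | .test φ => fun z w => w = z ∧ Formula.Holds M φ z

/-- Truth of a formula at a position of a spatial model. -/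
def Formula.Holds {Atm : Type u} {n : ℕ} (M : SpatialModel Atm n) :
    Formula Atm n → ℤ × ℤ → Prop
  | .atom p => fun z => p ∈ M.V z
  | .here i => fun z => M.P i = z
  | .neg φ => fun z => ¬ Formula.Holds M φ z
  | .and φ ψ => fun z => Formula.Holds M φ z ∧ Formula.Holds M ψ z
  | .box α φ => fun z => ∀ w : ℤ × ℤ, Program.Rel M α z w → Formula.Holds M φ w

end

/-- A formula is valid if it is true at every position of every spatial model. -/
def Formula.Valid {Atm : Type u} {n : ℕ} (φ : Formula Atm n) : Prop :=
  ∀ (M : SpatialModel Atm n) (z : ℤ × ℤ), φ.Holds M z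

/-- A formula is satisfiable if its negation is not valid. -/
def Formula.Satisfiable {Atm : Type u} {n : ℕ} (φ : Formula Atm n) : Prop :=
  ¬ φ.neg.Valid

/-! ### Gödel numbering

The code of an expression is the pair of a tag, naming its outermost constructor, and the code
of the arguments. The set of codes is shown to be primitive recursive, so that this gives a
`Primcodable` instance on formulas, with respect to which computability is understood. -/

mutual

/-- The Gödel number of a program. -/
def Program.code {Atm : Type u} [Encodable Atm] {n : ℕ} : Program Atm n → ℕ
  | .up => Nat.pair 1 0
  | .down => Nat.pair 2 0
  | .right => Nat.pair 3 0
  | .left => Nat.pair 4 0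
  | .seq α β => Nat.pair 5 (Nat.pair α.code β.code)
  | .choice α β => Nat.pair 6 (Nat.pair α.code β.code)
  | .iter α => Nat.pair 7 α.code
  | .test φ => Nat.pair 8 φ.code

/-- The Gödel number of a formula. -/
def Formula.code {Atm : Type u} [Encodable Atm] {n : ℕ} : Formula Atm n → ℕ
  | .atom p => Nat.pair 9 (Encodable.encode p)
  | .here i => Nat.pair 10 i
  | .neg φ => Nat.pair 11 φ.code
  | .and φ ψ => Nat.pair 12 (Nat.pair φ.code ψ.code)
  | .box α φ => Nat.pair 13 (Nat.pair α.code φ.code)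

end

mutual

theorem Program.code_inj {Atm : Type u} [Encodable Atm] {n : ℕ} :
    ∀ α β : Program Atm n, α.code = β.code → α = β
  | .up, β, h => by cases β <;> simp_all [Program.code]
  | .down, β, h => by cases β <;> simp_all [Program.code]
  | .right, β, h => by cases β <;> simp_all [Program.code]
  | .left, β, h => by cases β <;> simp_all [Program.code]
  | .seq α α', β, h => by
      cases β <;> simp [Program.code] at h
      rw [Program.code_inj α _ h.1, Program.code_inj α' _ h.2]
  | .choice α α', β, h => by
      cases β <;> simp [Program.code] at h
      rw [Program.code_inj α _ h.1, Program.code_inj α' _ h.2]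
  | .iter α, β, h => by
      cases β <;> simp [Program.code] at h
      rw [Program.code_inj α _ h]
  | .test φ, β, h => by
      cases β <;> simp [Program.code] at h
      rw [Formula.code_inj φ _ h]

theorem Formula.code_inj {Atm : Type u} [Encodable Atm] {n : ℕ} :
    ∀ φ ψ : Formula Atm n, φ.code = ψ.code → φ = ψ
  | .atom p, ψ, h => by cases ψ <;> simp_all [Formula.code]
  | .here i, ψ, h => by
      cases ψ <;> simp [Formula.code] at h
      rw [Fin.ext h]
  | .neg φ, ψ, h => by
      cases ψ <;> simp [Formula.code] at h
      rw [Formula.code_inj φ _ h]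
  | .and φ φ', ψ, h => by
      cases ψ <;> simp [Formula.code] at h
      rw [Formula.code_inj φ _ h.1, Formula.code_inj φ' _ h.2]
  | .box α φ, ψ, h => by
      cases ψ <;> simp [Formula.code] at h
      rw [Program.code_inj α _ h.1, Formula.code_inj φ _ h.2]

end

theorem mem_range_program_code (Atm : Type u) [Encodable Atm] (n t m : ℕ) :
    Nat.pair t m ∈ Set.range (Program.code (Atm := Atm) (n := n)) ↔
      ((t = 1 ∨ t = 2 ∨ t = 3 ∨ t = 4) ∧ m = 0) ∨
      ((t = 5 ∨ t = 6) ∧ m.unpair.1 ∈ Set.range (Program.code (Atm := Atm) (n := n)) ∧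
        m.unpair.2 ∈ Set.range (Program.code (Atm := Atm) (n := n))) ∨
      (t = 7 ∧ m ∈ Set.range (Program.code (Atm := Atm) (n := n))) ∨
      (t = 8 ∧ m ∈ Set.range (Formula.code (Atm := Atm) (n := n))) := by
  constructor
  · rintro ⟨α, h⟩
    cases α <;> simp only [Program.code, Nat.pair_eq_pair] at h <;> obtain ⟨rfl, rfl⟩ := h <;> simp
  · rintro (⟨rfl | rfl | rfl | rfl, rfl⟩ | ⟨rfl | rfl, ⟨α, h⟩, β, h'⟩ | ⟨rfl, α, h⟩ | ⟨rfl, φ, h⟩)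
    · exact ⟨.up, rfl⟩
    · exact ⟨.down, rfl⟩
    · exact ⟨.right, rfl⟩
    · exact ⟨.left, rfl⟩
    · exact ⟨.seq α β, by simp [Program.code, h, h']⟩
    · exact ⟨.choice α β, by simp [Program.code, h, h']⟩
    · exact ⟨.iter α, by simp [Program.code, h]⟩
    · exact ⟨.test φ, by simp [Program.code, h]⟩

theorem mem_range_formula_code (Atm : Type u) [Encodable Atm] (n t m : ℕ) :
    Nat.pair t m ∈ Set.range (Formula.code (Atm := Atm) (n := n)) ↔
      (t = 9 ∧ Encodable.encode (Encodable.decode m : Option Atm) = m + 1) ∨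
      (t = 10 ∧ m < n) ∨
      (t = 11 ∧ m ∈ Set.range (Formula.code (Atm := Atm) (n := n))) ∨
      (t = 12 ∧ m.unpair.1 ∈ Set.range (Formula.code (Atm := Atm) (n := n)) ∧
        m.unpair.2 ∈ Set.range (Formula.code (Atm := Atm) (n := n))) ∨
      (t = 13 ∧ m.unpair.1 ∈ Set.range (Program.code (Atm := Atm) (n := n)) ∧
        m.unpair.2 ∈ Set.range (Formula.code (Atm := Atm) (n := n))) := by
  constructor
  · rintro ⟨φ, h⟩
    cases φ <;> simp only [Formula.code, Nat.pair_eq_pair] at h <;> obtain ⟨rfl, rfl⟩ := h <;> simp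
  · rintro (⟨rfl, h⟩ | ⟨rfl, h⟩ | ⟨rfl, φ, h⟩ | ⟨rfl, ⟨φ, h⟩, ψ, h'⟩ | ⟨rfl, ⟨α, h⟩, φ, h'⟩)
    · cases hd : (Encodable.decode m : Option Atm) with
      | none => simp [hd] at h
      | some p =>
        refine ⟨.atom p, ?_⟩
        simp [hd] at h
        simp [Formula.code, h]
    · exact ⟨.here ⟨m, h⟩, rfl⟩
    · exact ⟨.neg φ, by simp [Formula.code, h]⟩
    · exact ⟨.and φ ψ, by simp [Formula.code, h, h']⟩
    · exact ⟨.box α φ, by simp [Formula.code, h, h']⟩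

open Classical in
/-- Whether a number is the code of a program, and whether it is the code of a formula. -/
noncomputable def kind (Atm : Type u) [Encodable Atm] (n c : ℕ) : Bool × Bool :=
  (decide (c ∈ Set.range (Program.code (Atm := Atm) (n := n))),
    decide (c ∈ Set.range (Formula.code (Atm := Atm) (n := n))))

/-- The course-of-values recursion step for `kind`: the argument lists the earlier values. -/
def kindStep (Atm : Type u) [Encodable Atm] (n : ℕ) (l : List (Bool × Bool)) : Bool × Bool :=
  let t := l.length.unpair.1
  let m := l.length.unpair.2
  let x := l.getD m (false, false)
  let y := l.getD m.unpair.1 (false, false)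
  let z := l.getD m.unpair.2 (false, false)
  ((((t == 1 || (t == 2 || (t == 3 || t == 4))) && m == 0) ||
      (((t == 5 || t == 6) && (y.1 && z.1)) || ((t == 7 && x.1) || (t == 8 && x.2)))),
    ((t == 9 && Encodable.encode (Encodable.decode m : Option Atm) == m + 1) ||
      ((t == 10 && decide (m < n)) ||
        ((t == 11 && x.2) || ((t == 12 && (y.2 && z.2)) || (t == 13 && (y.1 && z.2)))))))

theorem primrec_kindStep (Atm : Type u) [Primcodable Atm] (n : ℕ) :
    Primrec (kindStep Atm n) := by
  have ht : Primrec fun l : List (Bool × Bool) => l.length.unpair.1 :=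
    Primrec.fst.comp (Primrec.unpair.comp Primrec.list_length)
  have hm : Primrec fun l : List (Bool × Bool) => l.length.unpair.2 :=
    Primrec.snd.comp (Primrec.unpair.comp Primrec.list_length)
  have hx : Primrec fun l : List (Bool × Bool) => l.getD l.length.unpair.2 (false, false) :=
    (Primrec.list_getD _).comp Primrec.id hm
  have hy : Primrec fun l : List (Bool × Bool) =>
      l.getD l.length.unpair.2.unpair.1 (false, false) :=
    (Primrec.list_getD _).comp Primrec.id (Primrec.fst.comp (Primrec.unpair.comp hm))
  have hz : Primrec fun l : List (Bool × Bool) =>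
      l.getD l.length.unpair.2.unpair.2 (false, false) :=
    (Primrec.list_getD _).comp Primrec.id (Primrec.snd.comp (Primrec.unpair.comp hm))
  have eqc (k : ℕ) : Primrec fun l : List (Bool × Bool) => l.length.unpair.1 == k :=
    Primrec.beq.comp ht (Primrec.const k)
  have hd : Primrec fun l : List (Bool × Bool) =>
      Encodable.encode (Encodable.decode l.length.unpair.2 : Option Atm) ==
        l.length.unpair.2 + 1 :=
    Primrec.beq.comp (Primrec.encode.comp (Primrec.decode.comp hm)) (Primrec.succ.comp hm)
  have hlt : Primrec fun l : List (Bool × Bool) => decide (l.length.unpair.2 < n) :=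
    (Primrec.nat_lt.comp hm (Primrec.const n)).decide
  have f1 {f : List (Bool × Bool) → Bool × Bool} (h : Primrec f) : Primrec fun l => (f l).1 :=
    Primrec.fst.comp h
  have f2 {f : List (Bool × Bool) → Bool × Bool} (h : Primrec f) : Primrec fun l => (f l).2 :=
    Primrec.snd.comp h
  have o {f g : List (Bool × Bool) → Bool} (hf : Primrec f) (hg : Primrec g) :
      Primrec fun l => f l || g l := Primrec.or.comp hf hg
  have a {f g : List (Bool × Bool) → Bool} (hf : Primrec f) (hg : Primrec g) :
      Primrec fun l => f l && g l := Primrec.and.comp hf hg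
  exact Primrec.pair
    (o (a (o (eqc 1) (o (eqc 2) (o (eqc 3) (eqc 4)))) (Primrec.beq.comp hm (Primrec.const 0)))
      (o (a (o (eqc 5) (eqc 6)) (a (f1 hy) (f1 hz)))
        (o (a (eqc 7) (f1 hx)) (a (eqc 8) (f2 hx)))))
    (o (a (eqc 9) hd) (o (a (eqc 10) hlt) (o (a (eqc 11) (f2 hx))
      (o (a (eqc 12) (a (f2 hy) (f2 hz))) (a (eqc 13) (a (f1 hy) (f2 hz)))))))

theorem kindStep_eq (Atm : Type u) [Encodable Atm] (n c : ℕ) :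
    kindStep Atm n ((List.range c).map (kind Atm n)) = kind Atm n c := by
  obtain ⟨t, m, rfl⟩ : ∃ t m, c = Nat.pair t m := ⟨_, _, (Nat.pair_unpair c).symm⟩
  rcases Nat.eq_zero_or_pos t with rfl | ht
  · have h1 := mem_range_program_code Atm n 0 m
    have h2 := mem_range_formula_code Atm n 0 m
    simp at h1 h2
    simp [kindStep, kind, h1, h2]
  · have hlt : ∀ k ≤ m, k < Nat.pair t m := fun k hk => by
      have := Nat.add_le_pair t m
      omega
    have hget : ∀ k ≤ m, ((List.range (Nat.pair t m)).map (kind Atm n)).getD k (false, false)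
        = kind Atm n k := fun k hk => by simp [List.getD, hlt k hk]
    simp only [kindStep, List.length_map, List.length_range, Nat.unpair_pair, hget m le_rfl,
      hget _ (Nat.unpair_left_le m), hget _ (Nat.unpair_right_le m)]
    refine Prod.ext (Bool.eq_iff_iff.2 ?_) (Bool.eq_iff_iff.2 ?_)
    · have h := mem_range_program_code Atm n t m
      simp only [kind, decide_eq_true_eq, Bool.or_eq_true, Bool.and_eq_true, beq_iff_eq]
      exact h.symm
    · have h := mem_range_formula_code Atm n t m
      simp only [kind, decide_eq_true_eq, Bool.or_eq_true, Bool.and_eq_true, beq_iff_eq]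
      exact h.symm

theorem primrec_kind (Atm : Type u) [Primcodable Atm] (n : ℕ) : Primrec (kind Atm n) := by
  have h : Primrec₂ fun (_ : Unit) (c : ℕ) => kind Atm n c :=
    Primrec.nat_strong_rec (fun (_ : Unit) (c : ℕ) => kind Atm n c)
      (g := fun _ l => some (kindStep Atm n l))
      (Primrec.option_some.comp ((primrec_kindStep Atm n).comp Primrec.snd)).to₂
      (fun _ c => congrArg some (kindStep_eq Atm n c))
  exact h.comp (Primrec.const ()) Primrec.id

open Classical in
theorem primrecPred_range_code (Atm : Type u) [Primcodable Atm] (n : ℕ) :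
    PrimrecPred fun c : ℕ => c ∈ Set.range (Formula.code (Atm := Atm) (n := n)) :=
  ⟨inferInstance, Primrec.snd.comp (primrec_kind Atm n)⟩

open Classical in
/-- Formulas are effectively coded by their Gödel numbers. -/
noncomputable instance (Atm : Type u) [Primcodable Atm] (n : ℕ) : Primcodable (Formula Atm n) :=
  letI : Primcodable {c : ℕ // c ∈ Set.range (Formula.code (Atm := Atm) (n := n))} :=
    Primcodable.subtype (primrecPred_range_code Atm n)
  Primcodable.ofEquiv {c : ℕ // c ∈ Set.range (Formula.code (Atm := Atm) (n := n))}
    (Equiv.ofInjective Formula.code fun φ ψ h => Formula.code_inj φ ψ h)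

theorem encode_formula {Atm : Type u} [Primcodable Atm] {n : ℕ} (φ : Formula Atm n) :
    Encodable.encode φ = φ.code := rfl

end DLS

namespace DLS

universe u

/-! ### Programs that move by a fixed vector -/

-- The plane serves as the memory of a counter machine. A formula forces one atom `p` to hold at a
-- single position, which becomes the origin; no other atom is needed, and no agents. A state of the
-- registers is coded by `N = ∏ pᵢ ^ σ i` and stored as the point `(N, 0)` of the horizontal axis.
-- Although a program has no memory, it can multiply or divide `N` by a constant by walking along
-- two slanted lines (`Marks.rel_scale`), which increments or decrements a register.
--
-- Iteration and tests then give loops, zero tests and nondeterministic guesses. So the graph of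
-- every primitive recursive function is definable (`defGraph_of_primrec`), and guessing a register
-- adds an unbounded existential quantifier. Hence for primitive recursive `f` there are formulas `Φ
-- k`, primitive recursive in `k`, such that `Φ k` is satisfiable iff `f k s ≠ 0` for some `s`
-- (`exists_computable_formula`). With step-bounded evaluation as `f`, validity of `¬Φ k` expresses
-- that the `k`-th code diverges on `0`, which is not enumerable.

theorem reflTransGen_add {A : Type*} [AddMonoid A] (d x y : A) :
    Relation.ReflTransGen (fun a b => b = a + d) x y ↔ ∃ k : ℕ, y = x + k • d := by
  constructor
  · intro h
    induction h with
    | refl => exact ⟨0, by simp⟩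
    | tail _ h ih =>
      obtain ⟨k, rfl⟩ := ih
      exact ⟨k + 1, by rw [h, succ_nsmul, add_assoc]⟩
  · rintro ⟨k, rfl⟩
    induction k with
    | zero => simpa using Relation.ReflTransGen.refl
    | succ k ih => exact ih.tail (by rw [succ_nsmul, add_assoc])

theorem reflTransGen_iterate {A : Type*} (f : A → A) (x y : A) :
    Relation.ReflTransGen (fun a b => b = f a) x y ↔ ∃ k : ℕ, y = f^[k] x := by
  constructor
  · intro h
    induction h with
    | refl => exact ⟨0, rfl⟩
    | tail _ h ih =>
      obtain ⟨k, rfl⟩ := ih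
      exact ⟨k + 1, by rw [h, Function.iterate_succ_apply']⟩
  · rintro ⟨k, rfl⟩
    induction k with
    | zero => exact Relation.ReflTransGen.refl
    | succ k ih => exact ih.tail (Function.iterate_succ_apply' f k x)

variable {Atm : Type u} {n : ℕ}

/-- The program `α` always terminates, and moves by the vector `d`. -/
def Program.Translates (M : SpatialModel Atm n) (α : Program Atm n) (d : ℤ × ℤ) : Prop :=
  ∀ z w, α.Rel M z w ↔ w = z + d

namespace Program.Translates

variable {M : SpatialModel Atm n} {α β : Program Atm n} {d e : ℤ × ℤ}

theorem up : Translates M .up (0, 1) := fun z w => by simp [Program.Rel, Prod.ext_iff]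

theorem down : Translates M .down (0, -1) := fun z w => by
  simp [Program.Rel, Prod.ext_iff, sub_eq_add_neg]

theorem right : Translates M .right (1, 0) := fun z w => by simp [Program.Rel, Prod.ext_iff]

theorem left : Translates M .left (-1, 0) := fun z w => by
  simp [Program.Rel, Prod.ext_iff, sub_eq_add_neg]

theorem seq (hα : Translates M α d) (hβ : Translates M β e) :
    Translates M (.seq α β) (d + e) := fun z w => by
  simp only [Program.Rel, Relation.Comp, hα z, hβ _ w, exists_eq_left, add_assoc]

theorem rel_iter (hα : Translates M α d) (z w : ℤ × ℤ) :
    (Program.iter α).Rel M z w ↔ ∃ k : ℕ, w = z + k • d := by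
  have : α.Rel M = fun z w => w = z + d := by
    ext z w
    exact hα z w
  simp only [Program.Rel, this, reflTransGen_add]

end Program.Translates

/-- The `k`-fold sequential composition of a program; it makes no move if `k = 0`. -/
def Program.pow (α : Program Atm n) : ℕ → Program Atm n
  | 0 => .seq .up .down
  | k + 1 => .seq (α.pow k) α

theorem Program.Translates.pow {M : SpatialModel Atm n} {α : Program Atm n} {d : ℤ × ℤ}
    (hα : Translates M α d) : ∀ k, Translates M (α.pow k) (k • d)
  | 0 => by
    simpa [Program.pow, ← Prod.zero_eq_mk] using Translates.up.seq (Translates.down (M := M))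
  | k + 1 => by simpa only [succ_nsmul, Program.pow] using (Program.Translates.pow hα k).seq hα

theorem Program.rel_test (M : SpatialModel Atm n) (φ : Formula Atm n) (z w : ℤ × ℤ) :
    (Program.test φ).Rel M z w ↔ w = z ∧ φ.Holds M z := by simp only [Program.Rel]

theorem Program.rel_seq (M : SpatialModel Atm n) (α β : Program Atm n) (z w : ℤ × ℤ) :
    (Program.seq α β).Rel M z w ↔ ∃ v, α.Rel M z v ∧ β.Rel M v w := by
  simp only [Program.Rel, Relation.Comp]

theorem Program.rel_choice (M : SpatialModel Atm n) (α β : Program Atm n) (z w : ℤ × ℤ) :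
    (Program.choice α β).Rel M z w ↔ α.Rel M z w ∨ β.Rel M z w := by
  simp only [Program.Rel]

/-- The dual `⟨α⟩φ` of the box. -/
def Formula.dia (α : Program Atm n) (φ : Formula Atm n) : Formula Atm n :=
  .neg (.box α (.neg φ))

theorem Formula.holds_dia (M : SpatialModel Atm n) (α : Program Atm n) (φ : Formula Atm n)
    (z : ℤ × ℤ) : (Formula.dia α φ).Holds M z ↔ ∃ w, α.Rel M z w ∧ φ.Holds M w := by
  simp [Formula.dia, Formula.Holds]

/-! ### A marked origin -/

/-- The atom `p` is true exactly at `z`. -/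
def Marks (p : Atm) (M : SpatialModel Atm n) (z : ℤ × ℤ) : Prop :=
  ∀ w, p ∈ M.V w ↔ w = z

/-- The program moving to an arbitrary position in the same row. -/
def row : Program Atm n := .choice (.iter .right) (.iter .left)

/-- The program moving to an arbitrary position in the same column. -/
def column : Program Atm n := .choice (.iter .up) (.iter .down)

theorem rel_row (M : SpatialModel Atm n) (z w : ℤ × ℤ) : row.Rel M z w ↔ w.2 = z.2 := by
  rw [row, Program.rel_choice, Program.Translates.right.rel_iter,
    Program.Translates.left.rel_iter]
  simp only [Prod.ext_iff, Prod.fst_add, Prod.snd_add, Prod.smul_mk, nsmul_eq_mul]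
  constructor
  · rintro (⟨k, -, h⟩ | ⟨k, -, h⟩) <;> simpa using h
  · intro h
    rcases le_total z.1 w.1 with h' | h'
    · exact .inl ⟨(w.1 - z.1).toNat, by omega, by omega⟩
    · exact .inr ⟨(z.1 - w.1).toNat, by omega, by omega⟩

theorem rel_column (M : SpatialModel Atm n) (z w : ℤ × ℤ) : column.Rel M z w ↔ w.1 = z.1 := by
  rw [column, Program.rel_choice, Program.Translates.up.rel_iter,
    Program.Translates.down.rel_iter]
  simp only [Prod.ext_iff, Prod.fst_add, Prod.snd_add, Prod.smul_mk, nsmul_eq_mul]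
  constructor
  · rintro (⟨k, h, -⟩ | ⟨k, h, -⟩) <;> simpa using h
  · intro h
    rcases le_total z.2 w.2 with h' | h'
    · exact .inl ⟨(w.2 - z.2).toNat, by omega, by omega⟩
    · exact .inr ⟨(z.2 - w.2).toNat, by omega, by omega⟩

/-- A formula saying that the present position is the only one where `p` is true. -/
def markFormula (p : Atm) : Formula Atm n :=
  .and (.atom p) (.and
    (.and (.box (.seq .up (.seq (.iter .up) row)) (.neg (.atom p)))
      (.box (.seq .down (.seq (.iter .down) row)) (.neg (.atom p))))
    (.and (.box (.seq .right (.iter .right)) (.neg (.atom p)))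
      (.box (.seq .left (.iter .left)) (.neg (.atom p)))))

/-- The four boxes cover all rows above, all rows below, and the two halves of the present row. -/
theorem holds_markFormula (p : Atm) (M : SpatialModel Atm n) (z : ℤ × ℤ) :
    (markFormula p).Holds M z ↔ Marks p M z := by
  have move (α : Program Atm n) {d : ℤ × ℤ} (hα : α.Translates M d) (w : ℤ × ℤ) :
      (Program.seq α (.iter α)).Rel M z w ↔ ∃ k : ℕ, w = z + (d + k • d) := by
    simp only [Program.rel_seq, hα z, hα.rel_iter, exists_eq_left, add_assoc]
  have move_row (α : Program Atm n) {d : ℤ × ℤ} (hα : α.Translates M d) (w : ℤ × ℤ) :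
      (Program.seq α (.seq (.iter α) row)).Rel M z w ↔
        ∃ k : ℕ, w.2 = (z + (d + k • d)).2 := by
    simp only [Program.rel_seq, hα z, hα.rel_iter, exists_eq_left, add_assoc, rel_row]
    constructor
    · rintro ⟨v, ⟨k, rfl⟩, h⟩
      exact ⟨k, h⟩
    · rintro ⟨k, h⟩
      exact ⟨_, ⟨k, rfl⟩, h⟩
  simp only [markFormula, Formula.Holds, move _ Program.Translates.right,
    move _ Program.Translates.left, move_row _ Program.Translates.up,
    move_row _ Program.Translates.down, Marks, Prod.ext_iff, Prod.fst_add, Prod.snd_add,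
    Prod.smul_mk, nsmul_eq_mul]
  constructor
  · rintro ⟨h, ⟨hu, hd⟩, hr, hl⟩ w
    constructor
    · intro hw
      have h2 : w.2 = z.2 := by
        rcases lt_trichotomy w.2 z.2 with h' | h' | h'
        -- The first step is made outside the iteration, hence distance minus one.
        · exact absurd hw (hd w ⟨(z.2 - w.2 - 1).toNat, by omega⟩)
        · exact h'
        · exact absurd hw (hu w ⟨(w.2 - z.2 - 1).toNat, by omega⟩)
      refine ⟨?_, h2⟩
      rcases lt_trichotomy w.1 z.1 with h' | h' | h'
      · exact absurd hw (hl w ⟨(z.1 - w.1 - 1).toNat, by omega, by omega⟩)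
      · exact h'
      · exact absurd hw (hr w ⟨(w.1 - z.1 - 1).toNat, by omega, by omega⟩)
    · rintro ⟨h1, h2⟩
      rwa [Prod.ext h1 h2]
  · intro h
    simp only [h]
    refine ⟨by simp, ⟨?_, ?_⟩, ?_, ?_⟩
    · rintro w ⟨k, hk⟩; omega
    · rintro w ⟨k, hk⟩; omega
    · rintro w ⟨k, hk⟩; omega
    · rintro w ⟨k, hk⟩; omega

-- Multiplication by a fraction

section Marked

variable (p : Atm)

/-- In terms of the coordinates relative to the marked position, this program moves from `(N, 0)`
to `(i, 0)` if `b * i = a * N`. -/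
def scale (a b : ℕ) : Program Atm n :=
  .seq (.iter (.seq .left (Program.pow .up a)))
    (.seq (.test (.dia column (.atom p)))
      (.seq (.iter (.seq .right (Program.pow .down b))) (.test (.dia row (.atom p)))))

variable {p} {M : SpatialModel Atm n} {z : ℤ × ℤ}

/-- Both iterations are nondeterministic, but the tests fix their lengths. The first must stop in
the origin's column, so it makes `N` steps and reaches height `a * N`; the second descends by `b`
per step and must end at height `0`. -/
theorem Marks.rel_scale (hM : Marks p M z) (a b N : ℕ) (w : ℤ × ℤ) :
    (scale p a b).Rel M (z + ((N : ℤ), 0)) w ↔ ∃ i : ℕ, b * i = a * N ∧ w = z + ((i : ℤ), 0) := by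
  have hcol (v : ℤ × ℤ) : (Formula.dia column (.atom p)).Holds M v ↔ v.1 = z.1 := by
    simp only [Formula.holds_dia, rel_column, Formula.Holds, hM _, exists_eq_right]
    exact eq_comm
  have hrow (v : ℤ × ℤ) : (Formula.dia row (.atom p)).Holds M v ↔ v.2 = z.2 := by
    simp only [Formula.holds_dia, rel_row, Formula.Holds, hM _, exists_eq_right]
    exact eq_comm
  simp only [scale, Program.rel_seq, Program.rel_test, hcol, hrow,
    (Program.Translates.left.seq (Program.Translates.up.pow a)).rel_iter,
    (Program.Translates.right.seq (Program.Translates.down.pow b)).rel_iter]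
  constructor
  · rintro ⟨_, ⟨j, rfl⟩, _, ⟨rfl, hj⟩, _, ⟨i, rfl⟩, rfl, hi⟩
    simp at hj hi
    have hj' : (j : ℤ) = N := by omega
    rw [hj'] at hi
    refine ⟨i, ?_, ?_⟩
    · zify
      linarith
    · ext
      · simp; omega
      · simp [hj']; linarith
  · rintro ⟨i, hi, rfl⟩
    zify at hi
    refine ⟨_, ⟨N, rfl⟩, _, ⟨rfl, ?_⟩, _, ⟨i, rfl⟩, ?_, ?_⟩
    · simp
    · ext
      · simp
      · simp; linarith
    · simp; linarith

end Marked

end DLS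
namespace DLS

universe u

/-! ### Registers

A state of the registers is a finitely supported function `σ : ℕ →₀ ℕ`; it is represented by the
position `(∏ pᵢ ^ σ i, 0)` relative to the marked one, `pᵢ` being the `i`-th prime number. -/

/-- The product of the powers `pᵢ ^ σ i`, where `pᵢ` is the `i`-th prime number. -/
noncomputable def primePow (σ : ℕ →₀ ℕ) : ℕ := σ.prod fun i e => Nat.nth Nat.Prime i ^ e

theorem primePow_zero : primePow 0 = 1 := Finsupp.prod_zero_index

theorem primePow_add_single (σ : ℕ →₀ ℕ) (i : ℕ) :
    primePow (σ + Finsupp.single i 1) = Nat.nth Nat.Prime i * primePow σ := by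
  classical
  rw [primePow, Finsupp.prod_add_index' (by simp) (by simp [pow_add]),
    Finsupp.prod_single_index (by simp), pow_one, mul_comm, primePow]

theorem ne_zero_of_nth_prime_dvd {σ : ℕ →₀ ℕ} {i : ℕ} (h : Nat.nth Nat.Prime i ∣ primePow σ) :
    σ i ≠ 0 := by
  have hp := Nat.prime_nth_prime
  obtain ⟨j, hj, hd⟩ := (Prime.dvd_finsetProd_iff (hp i).prime _).1 h
  have := (Nat.prime_dvd_prime_iff_eq (hp i) (hp j)).1 ((hp i).dvd_of_dvd_pow hd)
  rw [Nat.nth_injective Nat.infinite_setOfPred_prime this]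
  exact Finsupp.mem_support_iff.1 hj

theorem exists_eq_add_single {σ : ℕ →₀ ℕ} {i : ℕ} (h : σ i ≠ 0) :
    ∃ τ, σ = τ + Finsupp.single i 1 := by
  classical
  refine ⟨σ - Finsupp.single i 1, (tsub_add_cancel_of_le ?_).symm⟩
  rw [Finsupp.single_le_iff]
  omega

/-- The position that represents the state `σ` if the marked position is `z`. -/
noncomputable def statePos (z : ℤ × ℤ) (σ : ℕ →₀ ℕ) : ℤ × ℤ := z + ((primePow σ : ℤ), 0)

variable {Atm : Type u} (p : Atm) (n : ℕ)

/-- A relation on states that some program computes, if `p` marks a position. -/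
def DefRel (R : (ℕ →₀ ℕ) → (ℕ →₀ ℕ) → Prop) : Prop :=
  ∃ α : Program Atm n, ∀ M z, Marks p M z → ∀ σ w,
    α.Rel M (statePos z σ) w ↔ ∃ τ, w = statePos z τ ∧ R σ τ

/-- A set of states that some formula defines, if `p` marks a position. -/
def DefPred (S : (ℕ →₀ ℕ) → Prop) : Prop :=
  ∃ φ : Formula Atm n, ∀ M z, Marks p M z → ∀ σ, φ.Holds M (statePos z σ) ↔ S σ

/-- A function on states that some program computes, if `p` marks a position. -/
def DefFun (f : (ℕ →₀ ℕ) → (ℕ →₀ ℕ)) : Prop := DefRel p n fun σ τ => τ = f σ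

variable {p n} {R R' : (ℕ →₀ ℕ) → (ℕ →₀ ℕ) → Prop} {S S' : (ℕ →₀ ℕ) → Prop}
  {f g : (ℕ →₀ ℕ) → (ℕ →₀ ℕ)}

-- Closure properties of definability

theorem DefRel.of_iff (h : DefRel p n R) (H : ∀ σ τ, R σ τ ↔ R' σ τ) : DefRel p n R' := by
  rwa [← (funext₂ fun σ τ => propext (H σ τ) : R = R')]

theorem DefPred.of_iff (h : DefPred p n S) (H : ∀ σ, S σ ↔ S' σ) : DefPred p n S' := by
  rwa [← (funext fun σ => propext (H σ) : S = S')]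

theorem DefPred.not (h : DefPred p n S) : DefPred p n fun σ => ¬ S σ := by
  obtain ⟨φ, hφ⟩ := h
  exact ⟨.neg φ, fun M z hM σ => by simp only [Formula.Holds, hφ M z hM]⟩

theorem DefPred.and (h : DefPred p n S) (h' : DefPred p n S') :
    DefPred p n fun σ => S σ ∧ S' σ := by
  obtain ⟨φ, hφ⟩ := h
  obtain ⟨ψ, hψ⟩ := h'
  exact ⟨.and φ ψ, fun M z hM σ => by simp only [Formula.Holds, hφ M z hM, hψ M z hM]⟩

theorem DefRel.dia (h : DefRel p n R) (h' : DefPred p n S) :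
    DefPred p n fun σ => ∃ τ, R σ τ ∧ S τ := by
  obtain ⟨α, hα⟩ := h
  obtain ⟨φ, hφ⟩ := h'
  refine ⟨.dia α φ, fun M z hM σ => ?_⟩
  simp only [Formula.holds_dia, hα M z hM]
  constructor
  · rintro ⟨_, ⟨τ, rfl, h⟩, h'⟩
    exact ⟨τ, h, (hφ M z hM τ).1 h'⟩
  · rintro ⟨τ, h, h'⟩
    exact ⟨_, ⟨τ, rfl, h⟩, (hφ M z hM τ).2 h'⟩

theorem DefRel.comp (h : DefRel p n R) (h' : DefRel p n R') :
    DefRel p n fun σ τ => ∃ ρ, R σ ρ ∧ R' ρ τ := by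
  obtain ⟨α, hα⟩ := h
  obtain ⟨β, hβ⟩ := h'
  refine ⟨.seq α β, fun M z hM σ w => ?_⟩
  simp only [Program.rel_seq, hα M z hM]
  constructor
  · rintro ⟨_, ⟨ρ, rfl, h⟩, h'⟩
    obtain ⟨τ, rfl, hτ⟩ := (hβ M z hM ρ w).1 h'
    exact ⟨τ, rfl, ρ, h, hτ⟩
  · rintro ⟨τ, rfl, ρ, h, h'⟩
    exact ⟨_, ⟨ρ, rfl, h⟩, (hβ M z hM ρ _).2 ⟨τ, rfl, h'⟩⟩

/-- From a point that represents a state, the program reaches only such points, so a run of the loop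
lifts step by step to a chain of states. -/
theorem DefRel.star (h : DefRel p n R) : DefRel p n (Relation.ReflTransGen R) := by
  obtain ⟨α, hα⟩ := h
  refine ⟨.iter α, fun M z hM σ w => ?_⟩
  simp only [Program.Rel]
  constructor
  · intro h
    induction h with
    | refl => exact ⟨σ, rfl, .refl⟩
    | tail _ h ih =>
      obtain ⟨ρ, rfl, h'⟩ := ih
      obtain ⟨τ, rfl, hτ⟩ := (hα M z hM ρ _).1 h
      exact ⟨τ, rfl, h'.tail hτ⟩
  · rintro ⟨τ, rfl, h⟩
    induction h with
    | refl => exact .refl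
    | tail _ h ih => exact ih.tail ((hα M z hM _ _).2 ⟨_, rfl, h⟩)

theorem DefPred.test (h : DefPred p n S) : DefRel p n fun σ τ => τ = σ ∧ S σ := by
  obtain ⟨φ, hφ⟩ := h
  refine ⟨.test φ, fun M z hM σ w => ?_⟩
  simp only [Program.rel_test, hφ M z hM]
  constructor
  · rintro ⟨rfl, h⟩
    exact ⟨σ, rfl, rfl, h⟩
  · rintro ⟨τ, rfl, rfl, h⟩
    exact ⟨rfl, h⟩

theorem DefFun.comp (hg : DefFun p n g) (hf : DefFun p n f) : DefFun p n (g ∘ f) :=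
  (DefRel.comp hf hg).of_iff (by simp)

theorem DefFun.preimage (hf : DefFun p n f) (hS : DefPred p n S) :
    DefPred p n fun σ => S (f σ) :=
  (DefRel.dia hf hS).of_iff (by simp)

theorem DefFun.exists_iterate (hf : DefFun p n f) (hS : DefPred p n S) :
    DefPred p n fun σ => ∃ k : ℕ, S (f^[k] σ) :=
  ((DefRel.star hf).dia hS).of_iff fun σ => by
    simp only [reflTransGen_iterate]
    constructor
    · rintro ⟨_, ⟨k, rfl⟩, h⟩
      exact ⟨k, h⟩
    · rintro ⟨k, h⟩
      exact ⟨_, ⟨k, rfl⟩, h⟩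

-- Register instructions and tests

variable (p n) in
theorem defFun_increment (i : ℕ) : DefFun p n fun σ => σ + Finsupp.single i 1 := by
  refine ⟨scale p (Nat.nth Nat.Prime i) 1, fun M z hM σ w => ?_⟩
  rw [statePos, hM.rel_scale]
  simp [statePos, primePow_add_single]

-- Division by `pᵢ` has no run unless `pᵢ` divides the code, so the program blocks when register `i`
-- is zero. This failure yields the zero test.
variable (p n) in
theorem defRel_decrement (i : ℕ) : DefRel p n fun σ τ => σ = τ + Finsupp.single i 1 := by
  refine ⟨scale p 1 (Nat.nth Nat.Prime i), fun M z hM σ w => ?_⟩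
  have hpos := (Nat.prime_nth_prime i).pos
  rw [statePos, hM.rel_scale]
  constructor
  · rintro ⟨k, hk, rfl⟩
    rw [one_mul] at hk
    obtain ⟨τ, rfl⟩ := exists_eq_add_single (ne_zero_of_nth_prime_dvd ⟨k, hk.symm⟩)
    rw [primePow_add_single] at hk
    exact ⟨τ, by rw [statePos, Nat.eq_of_mul_eq_mul_left hpos hk], rfl⟩
  · rintro ⟨τ, rfl, rfl⟩
    exact ⟨_, by rw [primePow_add_single, one_mul], rfl⟩

theorem reflTransGen_decrement (d σ τ : ℕ →₀ ℕ) :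
    Relation.ReflTransGen (fun σ τ => σ = τ + d) σ τ ↔ ∃ k : ℕ, σ = τ + k • d := by
  rw [← reflTransGen_add, ← Relation.reflTransGen_swap]

variable (p n) in
theorem defPred_true : DefPred p n fun _ => True :=
  ⟨.neg (.and (.atom p) (.neg (.atom p))), by simp [Formula.Holds]⟩

variable (p n) in
theorem defPred_eq_zero (i : ℕ) : DefPred p n fun σ => σ i = 0 := by
  refine ((defRel_decrement p n i).dia (defPred_true p n)).not.of_iff fun σ => ?_
  constructor
  · intro h
    by_contra hi
    obtain ⟨τ, hτ⟩ := exists_eq_add_single hi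
    exact h ⟨τ, hτ, trivial⟩
  · rintro h ⟨τ, rfl, -⟩
    simp at h

-- Decrement both registers together in a loop; they can reach zero at the same time iff they were
-- equal.
variable (p n) in
theorem defPred_eq (i j : ℕ) : DefPred p n fun σ => σ i = σ j := by
  classical
  -- For `i = j` the loop would subtract two per round and test evenness instead.
  rcases eq_or_ne i j with rfl | hij
  · simpa using defPred_true p n
  refine ((((defRel_decrement p n i).comp (defRel_decrement p n j)).star).dia
    ((defPred_eq_zero p n i).and (defPred_eq_zero p n j))).of_iff fun σ => ?_
  have h : (fun σ τ : ℕ →₀ ℕ => ∃ ρ, σ = ρ + Finsupp.single i 1 ∧ ρ = τ + Finsupp.single j 1)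
      = fun σ τ => σ = τ + (Finsupp.single j 1 + Finsupp.single i 1) := by
    ext σ τ
    simp [add_assoc]
  simp only [h, reflTransGen_decrement]
  constructor
  · rintro ⟨τ, ⟨k, rfl⟩, h1, h2⟩
    simp [h1, h2, hij, hij.symm]
  · intro h
    refine ⟨(σ.erase i).erase j, ⟨σ i, ?_⟩, ?_, ?_⟩
    · ext x
      rcases eq_or_ne x i with rfl | hi
      · simp [hij]
      · rcases eq_or_ne x j with rfl | hj
        · simp [h, hi]
        · simp [hi, hj]
    · simp [hij]
    · simp

-- Looped decrements followed by looped increments guess a value; this is the source of existential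
-- quantification over registers.
variable (p n) in
theorem defRel_havoc (i : ℕ) : DefRel p n fun σ τ => ∃ a, τ = σ.update i a := by
  classical
  refine ((defRel_decrement p n i).star.comp (DefRel.star (defFun_increment p n i))).of_iff
    fun σ τ => ?_
  simp only [reflTransGen_decrement, reflTransGen_add]
  constructor
  · rintro ⟨ρ, ⟨k, rfl⟩, l, rfl⟩
    refine ⟨ρ i + l, ?_⟩
    ext x
    rcases eq_or_ne x i with rfl | hi
    · simp
    · simp [hi]
  · rintro ⟨a, rfl⟩
    refine ⟨σ.erase i, ⟨σ i, ?_⟩, a, ?_⟩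
    · ext x
      rcases eq_or_ne x i with rfl | hi
      · simp
      · simp [hi]
    · ext x
      rcases eq_or_ne x i with rfl | hi
      · simp
      · simp [hi]

theorem DefPred.exists_update (hS : DefPred p n S) (i : ℕ) :
    DefPred p n fun σ => ∃ a, S (σ.update i a) :=
  ((defRel_havoc p n i).dia hS).of_iff fun σ => by
    constructor
    · rintro ⟨_, ⟨a, rfl⟩, h⟩
      exact ⟨a, h⟩
    · rintro ⟨a, h⟩
      exact ⟨_, ⟨a, rfl⟩, h⟩

/-- Assignment of the value of an expression to a register on which it does not depend. -/
theorem DefPred.assign {F : (ℕ →₀ ℕ) → ℕ} {i : ℕ} (h : DefPred p n fun σ => σ i = F σ)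
    (hF : ∀ σ a, F (σ.update i a) = F σ) : DefFun p n fun σ => σ.update i (F σ) :=
  -- Guess the new value, then check it; `hF` ensures that the guess does not alter the value it is
  -- compared with.
  ((defRel_havoc p n i).comp h.test).of_iff fun σ τ => by
    constructor
    · rintro ⟨_, ⟨a, rfl⟩, rfl, h⟩
      rw [hF, Finsupp.update_apply, if_pos rfl] at h
      rw [h]
    · rintro rfl
      exact ⟨_, ⟨F σ, rfl⟩, rfl, by simp [hF]⟩

/-! ### Primitive recursive functions -/

/-- The graph of `f` is definable, whichever registers hold the arguments and the value. -/
def DefGraph (p : Atm) (n : ℕ) {m : ℕ} (f : List.Vector ℕ m → ℕ) : Prop :=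
  ∀ (xs : List.Vector ℕ m) (y : ℕ), DefPred p n fun σ => σ y = f (xs.map σ)

theorem map_congr_vector {m : ℕ} {xs : List.Vector ℕ m} {σ τ : ℕ → ℕ}
    (h : ∀ x ∈ xs.toList, σ x = τ x) : xs.map σ = xs.map τ := by
  apply List.Vector.toList_injective
  simpa using h

theorem defGraph_succ : DefGraph p n (m := 1) fun v => v.head.succ := fun xs y => by
  -- The successor is computed in a fresh register, so that the argument and `y` stay intact.
  obtain ⟨z, hz⟩ := Infinite.exists_notMem_finset {xs.head, y}
  simp only [Finset.mem_insert, Finset.mem_singleton, not_or] at hz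
  have h1 := (defPred_eq p n z xs.head).assign fun σ a => by simp [Ne.symm hz.1]
  refine (h1.preimage ((defFun_increment p n z).preimage (defPred_eq p n z y))).of_iff fun σ => ?_
  simp [Ne.symm hz.2, List.Vector.head_map, eq_comm]

/-- The values are written one by one from register `B` on, above all arguments, so no write spoils
a later evaluation. -/
theorem exists_defFun_update {m k : ℕ} (B : ℕ) (g : Fin k → List.Vector ℕ m → ℕ)
    (hg : ∀ i, DefGraph p n (g i)) (xs : List.Vector ℕ m) (hB : ∀ x ∈ xs.toList, x < B) :
    ∀ j ≤ k, ∃ f, DefFun p n f ∧ (∀ σ, ∀ x < B, f σ x = σ x) ∧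
      ∀ σ (i : Fin k), i < j → f σ (B + i) = g i (xs.map σ)
  | 0, _ => ⟨id, (defPred_true p n).test.of_iff (by simp), by simp, by simp⟩
  | j + 1, hj => by
    obtain ⟨f, hf, h1, h2⟩ := exists_defFun_update B g hg xs hB j (by omega)
    have ha := (hg ⟨j, hj⟩ xs (B + j)).assign fun σ a =>
      congrArg _ (map_congr_vector fun x hx => by
        have := hB x hx
        rw [Finsupp.update_apply, if_neg (by omega)])
    refine ⟨_, ha.comp hf, fun σ x hx => ?_, fun σ i hi => ?_⟩
    · rw [Function.comp_apply, Finsupp.update_apply, if_neg (by omega), h1 σ x hx]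
    · rw [Function.comp_apply, Finsupp.update_apply]
      split_ifs with h
      · have hij : i = ⟨j, hj⟩ := Fin.ext (by simpa using h)
        rw [hij, map_congr_vector fun x hx => h1 σ x (hB x hx)]
      · exact h2 σ i (by omega)

theorem DefGraph.comp {m k : ℕ} {f : List.Vector ℕ k → ℕ} (hf : DefGraph p n f)
    {g : Fin k → List.Vector ℕ m → ℕ} (hg : ∀ i, DefGraph p n (g i)) :
    DefGraph p n fun v => f (List.Vector.ofFn fun i => g i v) := fun xs y => by
  obtain ⟨B, hB⟩ := (insert y xs.toList.toFinset).bddAbove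
  have hB' {x} (hx : x ∈ xs.toList) : x < B + 1 := Nat.lt_succ_of_le (hB (by simp [hx]))
  have hy : y < B + 1 := Nat.lt_succ_of_le (hB (by simp))
  obtain ⟨h, hh, h1, h2⟩ := exists_defFun_update (B + 1) g hg xs (fun x => hB') k le_rfl
  refine (hh.preimage (hf (List.Vector.ofFn fun i => B + 1 + i) y)).of_iff fun σ => ?_
  rw [h1 σ y hy]
  have : (List.Vector.ofFn fun i : Fin k => B + 1 + (i : ℕ)).map (h σ) =
      List.Vector.ofFn fun i => g i (xs.map σ) := by
    ext i
    simp [h2]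
  rw [this]

theorem DefGraph.prec {m : ℕ} {f : List.Vector ℕ m → ℕ} (hf : DefGraph p n f)
    {g : List.Vector ℕ (m + 2) → ℕ} (hg : DefGraph p n g) :
    DefGraph p n fun v : List.Vector ℕ (m + 1) =>
      v.head.rec (f v.tail) fun y IH => g (y ::ᵥ IH ::ᵥ v.tail) := fun xs y => by
  obtain ⟨B, hB⟩ := (insert y (insert xs.head xs.tail.toList.toFinset)).bddAbove
  have hxs {x} (hx : x ∈ xs.tail.toList) : x ≤ B := hB (by simp [hx])
  have hx : xs.head ≤ B := hB (by simp)
  have hy : y ≤ B := hB (by simp)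
  -- Register `B + 1` is the loop counter and `B + 2` the accumulator. The next value goes through
  -- `B + 3`, since an assigned register may not occur in its own expression.
  have hk := (defPred_eq_zero p n (B + 1)).assign fun _ _ => rfl
  have hr := (hf xs.tail (B + 2)).assign fun σ a => congrArg f (map_congr_vector fun x hx => by
    have := hxs hx
    rw [Finsupp.update_apply, if_neg (by omega)])
  have ht := (hg ((B + 1) ::ᵥ (B + 2) ::ᵥ xs.tail) (B + 3)).assign fun σ a =>
    congrArg g (map_congr_vector fun x hx => by
      simp only [List.Vector.toList_cons, List.mem_cons] at hx
      have : x ≤ B + 2 := by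
        rcases hx with rfl | rfl | hx
        · omega
        · omega
        · exact (hxs hx).trans (by omega)
      rw [Finsupp.update_apply, if_neg (by omega)])
  have hr' := (defPred_eq p n (B + 2) (B + 3)).assign fun σ a => by simp
  have hstep := (defFun_increment p n (B + 1)).comp (hr'.comp ht)
  refine ((hr.comp hk).preimage (hstep.exists_iterate
    ((defPred_eq p n (B + 1) xs.head).and (defPred_eq p n (B + 2) y)))).of_iff fun σ => ?_
  set step := (fun σ => σ + Finsupp.single (B + 1) 1) ∘ _ with hs
  set start := ((fun σ : ℕ →₀ ℕ => σ.update (B + 2) (f (xs.tail.map σ))) ∘ _) σ with hi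
  set F : ℕ → ℕ := fun j => Nat.rec (f (xs.tail.map σ))
    (fun y IH => g (y ::ᵥ IH ::ᵥ xs.tail.map σ)) j with hF
  -- Loop invariant after `j` rounds.
  have key (j : ℕ) : (step^[j] start) (B + 1) = j ∧ (step^[j] start) (B + 2) = F j ∧
      ∀ x ≤ B, (step^[j] start) x = σ x := by
    induction j with
    | zero =>
      refine ⟨by simp [hi], ?_, fun x hx => ?_⟩
      · simp only [hi, hF, Function.iterate_zero, id, Function.comp_apply]
        rw [Finsupp.update_apply, if_pos rfl]
        exact congrArg f (map_congr_vector fun x hx => by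
          have := hxs hx
          rw [Finsupp.update_apply, if_neg (by omega)])
      · simp only [hi, Function.iterate_zero, id, Function.comp_apply]
        rw [Finsupp.update_apply, if_neg (by omega), Finsupp.update_apply, if_neg (by omega)]
    | succ j ih =>
      obtain ⟨h1, h2, h3⟩ := ih
      rw [Function.iterate_succ_apply']
      generalize step^[j] start = τ at h1 h2 h3
      refine ⟨by simp [hs, h1], ?_, fun x hx => ?_⟩
      · have : xs.tail.map τ = xs.tail.map σ := map_congr_vector fun x hx => h3 x (hxs hx)
        simp [hs, h1, h2, this, hF]
      · simp only [hs, Function.comp_apply, Finsupp.add_apply]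
        rw [Finsupp.update_apply, if_neg (by omega), Finsupp.update_apply, if_neg (by omega),
          Finsupp.single_apply, if_neg (by omega), add_zero, h3 x hx]
  -- The loop may stop after any number of rounds; the test on the counter leaves only the round
  -- given by the head.
  simp only [(key _).1, (key _).2.1, (key _).2.2 _ hx, (key _).2.2 _ hy, exists_eq_left]
  rw [eq_comm, hF, List.Vector.head_map, List.Vector.tail_map]

theorem defGraph_of_primrec (p : Atm) (n : ℕ) {m : ℕ} {f : List.Vector ℕ m → ℕ}
    (hf : Nat.Primrec' f) : DefGraph p n f := by
  induction hf with
  | zero => exact fun _ y => defPred_eq_zero p n y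
  | succ => exact defGraph_succ
  | get i => exact fun xs y => (defPred_eq p n y (xs.get i)).of_iff (by simp)
  | comp g _ _ hf hg => exact hf.comp hg
  | prec _ _ hf hg => exact hf.prec hg

/-- Projections of primitive recursive relations are definable. -/
theorem defPred_exists_of_primrec (p : Atm) (n : ℕ) {f : ℕ → ℕ → ℕ} (hf : Primrec₂ f) :
    DefPred p n fun σ => ∃ s, f (σ 0) s ≠ 0 := by
  have h := defGraph_of_primrec p n (Nat.Primrec'.prim_iff₂.2 hf) (0 ::ᵥ 1 ::ᵥ .nil) 2
  refine ((h.and (defPred_eq_zero p n 2).not).exists_update 2 |>.exists_update 1).of_iff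
    fun σ => ?_
  simp

end DLS
namespace DLS

universe u

/-! ### The reduction -/

variable {Atm : Type u} {n : ℕ}

/-- Encodings are Gödel numbers by definition, so a constructor acts on them by pairing with its
tag. -/
theorem primrec_neg [Primcodable Atm] : Primrec (Formula.neg : Formula Atm n → Formula Atm n) :=
  Primrec.encode_iff.1 (Primrec₂.natPair.comp (Primrec.const 11) Primrec.encode)

theorem primrec_and [Primcodable Atm] (φ : Formula Atm n) : Primrec (Formula.and φ) :=
  Primrec.encode_iff.1 (Primrec₂.natPair.comp (Primrec.const 12)
    (Primrec₂.natPair.comp (Primrec.const φ.code) Primrec.encode))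

theorem primrec_box [Primcodable Atm] (α : Program Atm n) : Primrec (Formula.box α) :=
  Primrec.encode_iff.1 (Primrec₂.natPair.comp (Primrec.const 13)
    (Primrec₂.natPair.comp (Primrec.const α.code) Primrec.encode))

/-- A box over a program computing a function acts as substitution. -/
theorem holds_iterate_box {α : Program Atm n} {f : (ℕ →₀ ℕ) → (ℕ →₀ ℕ)}
    {M : SpatialModel Atm n} {z : ℤ × ℤ}
    (hα : ∀ σ w, α.Rel M (statePos z σ) w ↔ ∃ τ, w = statePos z τ ∧ τ = f σ)
    (φ : Formula Atm n) (k : ℕ) (σ : ℕ →₀ ℕ) :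
    ((Formula.box α)^[k] φ).Holds M (statePos z σ) ↔ φ.Holds M (statePos z (f^[k] σ)) := by
  induction k generalizing σ with
  | zero => rfl
  | succ k ih =>
    rw [Function.iterate_succ_apply', Function.iterate_succ_apply, ← ih]
    simp only [Formula.Holds, hα, exists_eq_right, forall_eq]

theorem exists_computable_formula [Primcodable Atm] [Nonempty Atm] (n : ℕ) {f : ℕ → ℕ → ℕ}
    (hf : Primrec₂ f) : ∃ Φ : ℕ → Formula Atm n, Primrec Φ ∧
      ∀ k, (∃ M z, (Φ k).Holds M z) ↔ ∃ s, f k s ≠ 0 := by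
  obtain ⟨p⟩ := ‹Nonempty Atm›
  obtain ⟨ψ, hψ⟩ := defPred_exists_of_primrec p n hf
  obtain ⟨α, hα⟩ := defFun_increment p n 0
  -- One step right of the origin is the code `1` of the zero state. The input `k` is loaded by `k`
  -- boxes over one fixed increment program, so `Φ` is primitive recursive.
  refine ⟨fun k => .and (markFormula p) (.box .right ((Formula.box α)^[k] ψ)),
    (primrec_and _).comp ((primrec_box _).comp
      (Primrec.nat_iterate Primrec.id (Primrec.const ψ) ((primrec_box α).comp Primrec.snd).to₂)),
    fun k => ?_⟩
  have hk (M : SpatialModel Atm n) (z : ℤ × ℤ) (hM : Marks p M z) :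
      (Formula.box .right ((Formula.box α)^[k] ψ)).Holds M z ↔ ∃ s, f k s ≠ 0 := by
    have h0 : z + (1, 0) = statePos z 0 := by simp [statePos, primePow_zero]
    have hit (j : ℕ) : (fun σ => σ + Finsupp.single 0 1)^[j] (0 : ℕ →₀ ℕ) = Finsupp.single 0 j := by
      induction j with
      | zero => simp
      | succ j ih => rw [Function.iterate_succ_apply', ih, ← Finsupp.single_add]
    simp only [Formula.Holds, Program.Translates.right z _, forall_eq, h0]
    rw [holds_iterate_box (hα M z hM), hψ M z hM, hit]
    simp only [Finsupp.single_eq_same]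
  constructor
  · rintro ⟨M, z, h⟩
    simp only [Formula.Holds] at h
    exact (hk M z ((holds_markFormula p M z).1 h.1)).1 (by simpa only [Formula.Holds] using h.2)
  · intro h
    let M : SpatialModel Atm n := ⟨fun _ => 0, fun w => {_a | w = 0}⟩
    have hM : Marks p M 0 := fun w => Iff.rfl
    refine ⟨M, 0, ?_⟩
    simp only [Formula.Holds]
    exact ⟨(holds_markFormula p M 0).2 hM, by simpa only [Formula.Holds] using (hk M 0 hM).2 h⟩

-- Reduction from the halting problem

theorem not_rePred_valid (Atm : Type u) [Primcodable Atm] [Nonempty Atm] (n : ℕ) :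
    ¬ REPred fun φ : Formula Atm n => φ.Valid := by
  intro h
  -- The encoding of an `Option` is `0` exactly for `none`, so a nonzero value means halting within
  -- bound `s`.
  let f : ℕ → ℕ → ℕ := fun k s =>
    Encodable.encode (Nat.Partrec.Code.evaln s (Denumerable.ofNat Nat.Partrec.Code k) 0)
  have hf : Primrec₂ f := Primrec.encode.comp (Nat.Partrec.Code.primrec_evaln.comp
    ((Primrec.snd.pair ((Primrec.ofNat _).comp Primrec.fst)).pair (Primrec.const 0)))
  obtain ⟨Φ, hΦ, hsat⟩ := exists_computable_formula (Atm := Atm) n hf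
  refine ComputablePred.halting_problem_not_re 0 ?_
  have hre : REPred fun c : Nat.Partrec.Code => (Φ (Encodable.encode c)).neg.Valid :=
    Partrec.comp h (primrec_neg.comp (hΦ.comp Primrec.encode)).to_comp
  refine hre.of_eq fun c => ?_
  have hc := hsat (Encodable.encode c)
  have hd : (∃ s, f (Encodable.encode c) s ≠ 0) ↔ (Nat.Partrec.Code.eval c 0).Dom := by
    simp only [f, Denumerable.ofNat_encode, Part.dom_iff_mem, Nat.Partrec.Code.evaln_complete]
    rw [exists_comm]
    refine exists_congr fun s => ?_
    cases Nat.Partrec.Code.evaln s c 0 <;> simp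
  rw [← hd, ← hc]
  simp [Formula.Valid, Formula.Holds]

/-- A formula is valid iff its negation is unsatisfiable, so a decision procedure would make
validity enumerable. -/
theorem not_computablePred_satisfiable (Atm : Type u) [Primcodable Atm] [Nonempty Atm] (n : ℕ) :
    ¬ ComputablePred fun φ : Formula Atm n => φ.Satisfiable := by
  intro h
  have h1 : ComputablePred fun φ : Formula Atm n => φ.neg.Satisfiable :=
    ComputablePred.computable_of_manyOneReducible ⟨_, primrec_neg.to_comp, fun _ => Iff.rfl⟩ h
  refine not_rePred_valid Atm n (h1.not.to_re.of_eq fun φ => ?_)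
  simp [Formula.Satisfiable, Formula.Valid, Formula.Holds]

end DLS

theorem mainTheorem1 (Atm : Type*) [Primcodable Atm] [Nonempty Atm] (n : ℕ) :
    (¬ REPred fun φ : DLS.Formula Atm n => φ.Valid) ∧
      ¬ ComputablePred fun φ : DLS.Formula Atm n => φ.Satisfiable :=
  ⟨DLS.not_rePred_valid Atm n, DLS.not_computablePred_satisfiable Atm n⟩
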